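/- **Definitions.** Let $(\mathcal X,d_{\mathcal X})$ and $(\mathcal Y,d_{\mathcal Y})$ be metric spaces. A map $f:\mathcal X\to\mathcal Y$ is a *bi-Lipschitz embedding* if there are a scale $s>0$ and a number $D\ge 1$ with $$ s\,d_{\mathcal X}(x,\tilde x)\le d_{\mathcal Y}(f(x),f(\tilde x))\le s\,D\,d_{\mathcal X}(x,\tilde x)\qquad\text{for all } x,\tilde x\in\mathcal X. $$ Its *distortion* $\operatorname{Dist}(f)$ is the smallest $D\ge1$ for which this holds for some $s>0$. **Proposition (Impossibility of Manifold Embedding of Fixed Finite Dimension).** Let $\mathcal R$ be a connected smooth Riemannian manifold of finite dimension, regarded as a metric space with its geodesic distance, and suppose that there is a bi-Lipschitz embedding of $\mathcal R$ into the real Hilbert space $\ell^2$. Then there is a constant $c_{\mathcal R}>0$, depending only on $\mathcal R$, such that for every positive integer $n$ there is an $n$-point metric space $(\mathcal X,d_{\mathcal X})$ for which every bi-Lipschitz embedding $f:\mathcal X\to\mathcal R$ satisfies $$ \operatorname{Dist}(f)\ \ge\ c_{\mathcal R}\,\frac{\log n}{\log\log n}, $$ where $\log$ is the natural logarithm and the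 right-hand side is read as $0$ when $n=1$. -/

import Mathlib

open scoped Manifold ContDiff Bundle
open Bundle (RiemannianBundle)

/-- `f` is a bi-Lipschitz embedding with scale `s > 0` and distortion at most `D`, where `D ≥ 1`:
`s * d(x, y) ≤ d(f x, f y) ≤ s * D * d(x, y)` for all `x`, `y`. -/
structure IsBiLipschitzWith {X Y : Type*} [MetricSpace X] [MetricSpace Y]
    (f : X → Y) (s D : ℝ) : Prop where
  scale_pos : 0 < s
  one_le : 1 ≤ D
  lower : ∀ x y : X, s * dist x y ≤ dist (f x) (f y)
  upper : ∀ x y : X, dist (f x) (f y) ≤ s * D * dist x y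

/-- `f` is a bi-Lipschitz embedding of metric spaces. -/
def IsBiLipschitzEmbedding {X Y : Type*} [MetricSpace X] [MetricSpace Y] (f : X → Y) : Prop :=
  ∃ s D : ℝ, IsBiLipschitzWith f s D

/-- The distortion of a bi-Lipschitz embedding `f`: the least `D ≥ 1` such that, for some scale
`s > 0`, `s * d(x, y) ≤ d(f x, f y) ≤ s * D * d(x, y)` for all `x`, `y`.
(It is only used for bi-Lipschitz embeddings; then the set below is nonempty, and it is
bounded below by `1`.) -/
noncomputable def distortion {X Y : Type*} [MetricSpace X] [MetricSpace Y] (f : X → Y) : ℝ :=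
  sInf {D : ℝ | ∃ s : ℝ, IsBiLipschitzWith f s D}

/-- The real Hilbert space `ℓ²` of square-summable sequences. -/
abbrev EllTwo : Type := lp (fun _ : ℕ => ℝ) 2

/-! ### Commuting orthogonal projections -/

section Projections

variable {V : Type*} [NormedAddCommGroup V] [InnerProductSpace ℝ V]

/-! Composing with the embedding into `EllTwo` costs only a constant factor, so hard finite spaces
for Hilbert space suffice. Take `F ^ D` with `|F| = q ≥ 2 * D` and the word metric generated by all
multiples of the moment-curve vectors, any `D` of which span (Vandermonde). Averagings along these
directions are commuting projections, and any `D` of them kill mean-zero functions. This gives a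
Poincaré inequality (`mul_sum_norm_sq_le`): the variance of a map is at most its squared Lipschitz
constant. But there are at most `q ^ 2` generators, so most pairs are at distance of order `D`,
forcing distortion of order `D`. With `q = 2 * D`, `D` is of order `log n / log log n` for `n = q ^
D`. -/

/-- If the product of any `D` of a family of commuting orthogonal projections kills `v`, then the
family is, on average, far from fixing `v`. -/
theorem sum_inner_le_of_list_prod_eq_zero {ι : Type*} (T : ι → Module.End ℝ V)
    (hsym : ∀ i, (T i).IsSymmetric) (hid : ∀ i, IsIdempotentElem (T i))
    (hcomm : ∀ i j, Commute (T i) (T j)) (s : Finset ι) :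
    ∀ (D : ℕ) (v : V), (∀ l : List ι, l.Nodup → (∀ i ∈ l, i ∈ s) → l.length = D →
      (l.map T).prod v = 0) → ∑ i ∈ s, inner ℝ (T i v) v ≤ ((D : ℝ) - 1) * ‖v‖ ^ 2 := by
  classical
  induction s using Finset.induction_on with
  | empty =>
    intro D v h
    rcases D with _ | D
    · have : v = 0 := by simpa using h [] (by simp) (by simp) rfl
      simp [this]
    · have : 0 ≤ (D : ℝ) * ‖v‖ ^ 2 := by positivity
      simpa using this
  | insert x s hx ih =>
    intro D v h
    rcases D with _ | D
    · have : v = 0 := by simpa using h [] (by simp) (by simp) rfl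
      simp [this]
    have hidx : ∀ w, T x (T x w) = T x w := fun w => by
      rw [← Module.End.mul_apply, (hid x).eq]
    have hc : ∀ i w, T i (T x w) = T x (T i w) := fun i w => by
      rw [← Module.End.mul_apply, (hcomm i x).eq, Module.End.mul_apply]
    have hcl : ∀ l : List ι, (l.map T).prod (T x v) = T x ((l.map T).prod v) := fun l => by
      have : Commute (l.map T).prod (T x) := by
        refine Commute.list_prod_left _ _ fun y hy => ?_
        obtain ⟨i, -, rfl⟩ := List.mem_map.1 hy
        exact hcomm i x
      rw [← Module.End.mul_apply, this.eq, Module.End.mul_apply]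
    -- On the range of `T x`, that projection already supplies one factor, so `D` others kill; on
    -- its kernel `D + 1` are still needed.
    have hg := ih D (T x v) fun l hl hls hlD => by
      have := h (x :: l) (List.nodup_cons.2 ⟨fun hxl => hx (hls x hxl), hl⟩)
        (by
          intro i hi
          rcases List.mem_cons.1 hi with rfl | hi
          · exact Finset.mem_insert_self _ _
          · exact Finset.mem_insert_of_mem (hls i hi)) (by simp [hlD])
      rw [hcl]
      simpa using this
    have hh := ih (D + 1) (v - T x v) fun l hl hls hlD => by
      have := h l hl (fun i hi => Finset.mem_insert_of_mem (hls i hi)) hlD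
      rw [map_sub, hcl, this]
      simp
    have horth : ∀ w, inner ℝ (T x w) (v - T x v) = 0 := fun w => by
      rw [hsym x, map_sub, hidx, sub_self, inner_zero_right]
    have horth' : ∀ w, inner ℝ (w - T x w) (T x v) = 0 := fun w => by
      rw [← hsym x, map_sub, hidx, sub_self, inner_zero_left]
    have hnorm : ‖v‖ ^ 2 = ‖T x v‖ ^ 2 + ‖v - T x v‖ ^ 2 := by
      have h1 : v = T x v + (v - T x v) := by abel
      conv_lhs => rw [h1]
      rw [norm_add_sq_real, horth]
      ring
    have hxx : inner ℝ (T x v) v = ‖T x v‖ ^ 2 := by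
      have h1 : v = T x v + (v - T x v) := by abel
      conv_lhs => rw [h1, map_add, map_sub, hidx, sub_self, add_zero, inner_add_right, horth]
      rw [real_inner_self_eq_norm_sq, add_zero]
    have hsplit : ∀ i, inner ℝ (T i v) v =
        inner ℝ (T i (T x v)) (T x v) + inner ℝ (T i (v - T x v)) (v - T x v) := fun i => by
      have h1 : v = T x v + (v - T x v) := by abel
      have h2 : inner ℝ (T i (T x v)) (v - T x v) = 0 := by rw [hc, horth]
      have h3 : inner ℝ (T i (v - T x v)) (T x v) = 0 := by rw [map_sub, hc, horth']
      conv_lhs => rw [h1, map_add, inner_add_left, inner_add_right, inner_add_right, h2, h3]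
      ring
    rw [Finset.sum_insert hx, Finset.sum_congr rfl fun i _ => hsplit i, Finset.sum_add_distrib,
      hxx, hnorm]
    push_cast at hg hh ⊢
    nlinarith

end Projections

/-! ### Line averages and the Poincaré inequality -/

section LineAverage

variable {F G H : Type*} [Field F] [Fintype F] [AddCommGroup G] [Module F G]
  [NormedAddCommGroup H] [InnerProductSpace ℝ H]

variable (F H) in
/-- Averaging a function on the vector space `G` along the lines with direction `w`. -/
noncomputable def lineAverage (w : G) : Module.End ℝ (PiLp 2 fun _ : G => H) where
  toFun f := WithLp.toLp 2 fun u => (Fintype.card F : ℝ)⁻¹ • ∑ y : F, f (u + y • w)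
  map_add' f g := by
    ext u
    simp [Finset.sum_add_distrib]
  map_smul' c f := by
    ext u
    simp [← Finset.smul_sum, smul_comm c]

theorem lineAverage_apply (w : G) (f : PiLp 2 fun _ : G => H) (u : G) :
    lineAverage F H w f u = (Fintype.card F : ℝ)⁻¹ • ∑ y : F, f (u + y • w) := rfl

theorem lineAverage_apply_add_smul (w : G) (f : PiLp 2 fun _ : G => H) (u : G) (z : F) :
    lineAverage F H w f (u + z • w) = lineAverage F H w f u := by
  rw [lineAverage_apply, lineAverage_apply]
  congr 1
  refine Fintype.sum_equiv (Equiv.addLeft z) _ _ fun y => ?_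
  simp [add_smul, add_assoc]

theorem isIdempotentElem_lineAverage (w : G) : IsIdempotentElem (lineAverage F H w) := by
  refine LinearMap.ext fun f => ?_
  ext u
  rw [Module.End.mul_apply, lineAverage_apply]
  simp only [lineAverage_apply_add_smul]
  have : (Fintype.card F : ℝ) ≠ 0 := by simp
  rw [Finset.sum_const, Finset.card_univ, ← Nat.cast_smul_eq_nsmul ℝ, smul_smul,
    inv_mul_cancel₀ this, one_smul]

theorem commute_lineAverage (w w' : G) : Commute (lineAverage F H w) (lineAverage F H w') := by
  refine LinearMap.ext fun f => ?_
  ext u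
  simp only [Module.End.mul_apply, lineAverage_apply, ← Finset.smul_sum]
  rw [Finset.sum_comm]
  simp only [add_right_comm]

/-- Translation by `y • w` is adjoint to translation by `-y • w`, and the average runs over all `y`.
-/
theorem isSymmetric_lineAverage [Fintype G] (w : G) : (lineAverage F H w).IsSymmetric := by
  intro f g
  simp only [PiLp.inner_apply, lineAverage_apply, inner_smul_left, inner_smul_right, sum_inner,
    inner_sum, ← Finset.mul_sum]
  congr 1
  refine Finset.sum_comm.trans (Eq.trans ?_ Finset.sum_comm)
  refine Fintype.sum_equiv (Equiv.neg F) _ _ fun y => ?_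
  refine Fintype.sum_equiv (Equiv.addRight (y • w)) _ _ fun u => ?_
  simp

theorem sum_lineAverage [Fintype G] (w : G) (f : PiLp 2 fun _ : G => H) :
    ∑ u, lineAverage F H w f u = ∑ u, f u := by
  simp only [lineAverage_apply, ← Finset.smul_sum]
  rw [Finset.sum_comm]
  have h : ∀ y : F, ∑ u, f (u + y • w) = ∑ u, f u := fun y =>
    Fintype.sum_equiv (Equiv.addRight (y • w)) _ _ fun u => by simp
  have : (Fintype.card F : ℝ) ≠ 0 := by simp
  simp only [h]
  rw [Finset.sum_const, Finset.card_univ, ← Nat.cast_smul_eq_nsmul ℝ, smul_smul,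
    inv_mul_cancel₀ this, one_smul]

/-- Averaging a function of mean zero along directions that span the space gives `0`. -/
theorem list_prod_lineAverage_eq_zero [Fintype G] {ι : Type*} (w : ι → G) (l : List ι)
    (hl : Submodule.span F (w '' {i | i ∈ l}) = ⊤) (f : PiLp 2 fun _ : G => H)
    (hf : ∑ u, f u = 0) : (l.map fun i => lineAverage F H (w i)).prod f = 0 := by
  set P := (l.map fun i => lineAverage F H (w i)).prod with hP
  have hsum : ∑ u, P f u = 0 := by
    rw [← hf, hP]
    clear hl hP P
    induction l with
    | nil => simp
    | cons i l ih => rw [List.map_cons, List.prod_cons, Module.End.mul_apply, sum_lineAverage, ih]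
  have hfix : ∀ i ∈ l, lineAverage F H (w i) * P = P := by
    rw [hP]
    clear hl hP hsum P
    induction l with
    | nil => simp
    | cons j l ih =>
      intro i hi
      rw [List.map_cons, List.prod_cons]
      rcases List.mem_cons.1 hi with rfl | hi
      · rw [← mul_assoc, (isIdempotentElem_lineAverage _).eq]
      · rw [← mul_assoc, (commute_lineAverage _ _).eq, mul_assoc, ih i hi]
  -- Invariance under each direction passes to their span, so `P f` is constant; its sum is still
  -- zero.
  have hinv : ∀ v : G, ∀ u, P f (u + v) = P f u := by
    intro v
    have hv : v ∈ Submodule.span F (w '' {i | i ∈ l}) := by rw [hl]; trivial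
    induction hv using Submodule.closure_induction with
    | zero => simp
    | add x y _ _ hx hy => intro u; rw [← add_assoc, hy, hx]
    | smul_mem c x hx =>
      obtain ⟨i, hi, rfl⟩ := hx
      intro u
      rw [← hfix i hi, Module.End.mul_apply, lineAverage_apply_add_smul]
  have hconst : ∀ u, P f u = P f 0 := fun u => by simpa using hinv u 0
  have h0 : P f 0 = 0 := by
    simp only [hconst] at hsum
    rw [Finset.sum_const, ← Nat.cast_smul_eq_nsmul ℝ] at hsum
    exact (smul_eq_zero.1 hsum).resolve_left (by simp)
  ext u
  rw [hconst, h0]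
  rfl

/-- A Poincaré inequality for Hilbert space valued functions on a finite vector space, for a
family of directions any `D` of which span. -/
theorem mul_sum_norm_sq_le [Fintype G] {ι : Type*} [Fintype ι] (w : ι → G) (D : ℕ)
    (hw : ∀ l : List ι, l.Nodup → l.length = D → Submodule.span F (w '' {i | i ∈ l}) = ⊤)
    (f : G → H) (hf : ∑ u, f u = 0) (K : ℝ)
    (hK : ∀ (i : ι) (y : F) (u : G), ‖f (u + y • w i) - f u‖ ^ 2 ≤ K) :
    2 * ((Fintype.card ι : ℝ) - D + 1) * ∑ u, ‖f u‖ ^ 2 ≤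
      Fintype.card ι * Fintype.card G * K := by
  set g : PiLp 2 fun _ : G => H := WithLp.toLp 2 f with hg
  have hgn : ‖g‖ ^ 2 = ∑ u, ‖f u‖ ^ 2 := by rw [PiLp.norm_sq_eq_of_L2]
  have key := sum_inner_le_of_list_prod_eq_zero (fun i => lineAverage F H (w i))
    (fun i => isSymmetric_lineAverage _) (fun i => isIdempotentElem_lineAverage _)
    (fun i j => commute_lineAverage _ _) Finset.univ D g
    fun l hl _ hlD => list_prod_lineAverage_eq_zero w l (hw l hl hlD) g hf
  have hq : (0 : ℝ) < Fintype.card F := by exact_mod_cast Fintype.card_pos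
  -- The left side is the mean over `y` of `∑ u, ‖f (u + y • w i) - f u‖ ^ 2`.
  have hi : ∀ i, 2 * ‖g‖ ^ 2 - 2 * inner ℝ (lineAverage F H (w i) g) g ≤ Fintype.card G * K := by
    intro i
    have h1 : inner ℝ (lineAverage F H (w i) g) g =
        (Fintype.card F : ℝ)⁻¹ * ∑ y : F, ∑ u, inner ℝ (f (u + y • w i)) (f u) := by
      simp only [PiLp.inner_apply, lineAverage_apply, inner_smul_left, sum_inner,
        ← Finset.mul_sum]
      rw [Finset.sum_comm]
      simp [hg]
    have h2 : ∀ y : F, 2 * ‖g‖ ^ 2 - 2 * ∑ u, inner ℝ (f (u + y • w i)) (f u) ≤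
        Fintype.card G * K := by
      intro y
      have h3 : ∑ u, ‖f (u + y • w i)‖ ^ 2 = ‖g‖ ^ 2 := by
        rw [hgn]
        exact Fintype.sum_equiv (Equiv.addRight (y • w i)) _ _ fun u => by simp
      calc _ = ∑ u, ‖f (u + y • w i) - f u‖ ^ 2 := by
            simp only [norm_sub_sq_real, Finset.sum_add_distrib, Finset.sum_sub_distrib,
              ← Finset.mul_sum, h3, ← hgn]
            ring
        _ ≤ ∑ _u : G, K := Finset.sum_le_sum fun u _ => hK i y u
        _ = _ := by simp
    have h4 := Finset.sum_le_sum fun (y : F) (_ : y ∈ Finset.univ) => h2 y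
    simp only [Finset.sum_sub_distrib, ← Finset.mul_sum, Finset.sum_const, Finset.card_univ, nsmul_eq_mul] at h4
    rw [h1, ← mul_le_mul_iff_right₀ hq]
    refine le_trans (le_of_eq ?_) (h4.trans (le_of_eq (by ring)))
    field_simp
  have h5 := Finset.sum_le_sum fun (i : ι) (_ : i ∈ Finset.univ) => hi i
  simp only [Finset.sum_sub_distrib, ← Finset.mul_sum, Finset.sum_const, Finset.card_univ, nsmul_eq_mul] at h5
  rw [← hgn]
  linarith

end LineAverage

/-! ### Word metrics on finite abelian groups -/

section WordMetric

open scoped Pointwise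

variable {G : Type*} [AddCommGroup G] [DecidableEq G]

/-- The length of the shortest word in the letters `B` with value `g`. -/
noncomputable def wordLength (B : Finset G) (g : G) : ℕ := sInf {r : ℕ | g ∈ r • B}

theorem wordLength_le {B : Finset G} {g : G} {r : ℕ} (h : g ∈ r • B) : wordLength B g ≤ r :=
  Nat.sInf_le h

theorem mem_wordLength_nsmul {B : Finset G} (hB : ∀ g : G, ∃ r : ℕ, g ∈ r • B) (g : G) :
    g ∈ wordLength B g • B :=
  Nat.sInf_mem (s := {r : ℕ | g ∈ r • B}) (hB g)

/-- The word metric of a generating set of an abelian group. -/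
@[reducible]
noncomputable def wordMetricSpace (B : Finset G) (hneg : -B = B)
    (hB : ∀ g : G, ∃ r : ℕ, g ∈ r • B) : MetricSpace G where
  dist u v := (wordLength B (u - v) : ℝ)
  dist_self u := by
    have : wordLength B (u - u) ≤ 0 := wordLength_le (by simp)
    simpa using this
  dist_comm u v := by
    have h : ∀ g : G, wordLength B (-g) ≤ wordLength B g := fun g => by
      refine wordLength_le ?_
      have := Finset.neg_mem_neg (mem_wordLength_nsmul hB g)
      rwa [← neg_nsmul, hneg] at this
    have h1 := h (u - v)
    have h2 := h (v - u)
    rw [neg_sub] at h1 h2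
    exact congrArg _ (le_antisymm h2 h1)
  dist_triangle u v w := by
    have : wordLength B (u - w) ≤ wordLength B (u - v) + wordLength B (v - w) := by
      refine wordLength_le ?_
      rw [add_nsmul, ← sub_add_sub_cancel u v w]
      exact Finset.add_mem_add (mem_wordLength_nsmul hB _) (mem_wordLength_nsmul hB _)
    exact_mod_cast this
  eq_of_dist_eq_zero {u v} h := by
    have h0 : wordLength B (u - v) = 0 := by exact_mod_cast h
    have := mem_wordLength_nsmul hB (u - v)
    rw [h0, zero_nsmul] at this
    exact sub_eq_zero.1 (by simpa using this)

/-- As `0 ∈ B`, the sumsets `r • B` increase with `r`, so the ball lies in `r • B`. -/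
theorem card_wordLength_le [Fintype G] {B : Finset G} (h0 : 0 ∈ B)
    (hB : ∀ g : G, ∃ r : ℕ, g ∈ r • B) (r : ℕ) :
    (Finset.univ.filter fun g => wordLength B g ≤ r).card ≤ B.card ^ r := by
  refine (Finset.card_le_card fun g hg => ?_).trans (Finset.card_nsmul_le (s := B) (n := r))
  exact Finset.nsmul_subset_nsmul_right h0 (Finset.mem_filter.1 hg).2 (mem_wordLength_nsmul hB g)

end WordMetric

/-! ### Spanning by moment-curve vectors -/

section Vandermonde

variable {F : Type*} [Field F]

theorem span_powers_eq_top (D : ℕ) (l : List F) (hl : l.Nodup) (hD : l.length = D) :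
    Submodule.span F ((fun (x : F) (j : Fin D) => x ^ (j : ℕ)) '' {i | i ∈ l}) = ⊤ := by
  subst hD
  have hinj : Function.Injective l.get := List.nodup_iff_injective_get.1 hl
  have hdet := Matrix.det_vandermonde_ne_zero_iff.2 hinj
  have hli : LinearIndependent F (Matrix.vandermonde l.get).row :=
    Matrix.linearIndependent_rows_iff_isUnit.2
      ((Matrix.isUnit_iff_isUnit_det _).2 (isUnit_iff_ne_zero.2 hdet))
  have hspan := hli.span_eq_top_of_card_eq_finrank' (by simp)
  rw [← top_le_iff, ← hspan]
  refine Submodule.span_mono ?_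
  rintro _ ⟨i, rfl⟩
  exact ⟨l.get i, List.get_mem _ _, rfl⟩

end Vandermonde

/-! ### Distortion in Hilbert space -/

section HilbertDistortion

open scoped Pointwise

theorem sum_norm_sub_sq {G H : Type*} [Fintype G] [NormedAddCommGroup H] [InnerProductSpace ℝ H]
    (f : G → H) (hf : ∑ u, f u = 0) :
    ∑ u, ∑ v, ‖f u - f v‖ ^ 2 = 2 * Fintype.card G * ∑ u, ‖f u‖ ^ 2 := by
  simp only [norm_sub_sq_real, Finset.sum_add_distrib, Finset.sum_sub_distrib, ← Finset.mul_sum,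
    ← inner_sum, hf, inner_zero_right, Finset.sum_const, Finset.card_univ, nsmul_eq_mul]
  ring

/-- The word metric on `F ^ D` for the generators `y • (1, x, …, x ^ (D - 1))`
embeds badly into Hilbert space. -/
theorem exists_metricSpace_le_distortion (F H : Type*) [Field F] [Fintype F]
    [NormedAddCommGroup H] [InnerProductSpace ℝ H] (D r : ℕ) (hr : 2 * r + 1 ≤ D)
    (hD : 2 * D ≤ Fintype.card F) :
    ∃ _ : MetricSpace (Fin D → F), ∀ (f : (Fin D → F) → H) (s K : ℝ),
      IsBiLipschitzWith f s K → (r : ℝ) + 1 ≤ 2 * K := by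
  classical
  set w : F → Fin D → F := fun x j => x ^ (j : ℕ)
  set B : Finset (Fin D → F) := Finset.univ.image fun p : F × F => p.2 • w p.1
  have hmem : ∀ x y : F, y • w x ∈ B := fun x y =>
    Finset.mem_image.2 ⟨(x, y), Finset.mem_univ _, rfl⟩
  have h0 : 0 ∈ B := by simpa using hmem 0 0
  have hsmul : ∀ c : F, ∀ g ∈ B, c • g ∈ B := by
    intro c g hg
    obtain ⟨p, -, rfl⟩ := Finset.mem_image.1 hg
    rw [smul_smul]
    exact hmem _ _
  have hneg : -B = B := by
    have h : ∀ g ∈ B, -g ∈ B := fun g hg => by simpa using hsmul (-1) g hg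
    ext g
    rw [Finset.mem_neg']
    exact ⟨fun hg => by simpa using h _ hg, h g⟩
  have hB : ∀ g : Fin D → F, ∃ r : ℕ, g ∈ r • B := by
    intro g
    obtain ⟨l, hlD, hl⟩ : ∃ l : List F, l.length = D ∧ l.Nodup := by
      obtain ⟨t, -, ht⟩ := Finset.exists_subset_card_eq
        (show D ≤ (Finset.univ : Finset F).card by rw [Finset.card_univ]; omega)
      exact ⟨t.toList, by simpa using ht, t.nodup_toList⟩
    have hg : g ∈ Submodule.span F (w '' {i | i ∈ l}) := by
      rw [span_powers_eq_top D l hl hlD]; trivial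
    induction hg using Submodule.closure_induction with
    | zero => exact ⟨0, by simp⟩
    | add x y _ _ hx hy =>
      obtain ⟨m, hm⟩ := hx
      obtain ⟨k, hk⟩ := hy
      exact ⟨m + k, by rw [add_nsmul]; exact Finset.add_mem_add hm hk⟩
    | smul_mem c x hx =>
      obtain ⟨i, -, rfl⟩ := hx
      exact ⟨1, by rw [one_nsmul]; exact hmem i c⟩
  refine ⟨wordMetricSpace B hneg hB, fun f s K hf => ?_⟩
  let _ := wordMetricSpace B hneg hB
  have hdist : ∀ u v : Fin D → F, dist u v = wordLength B (u - v) := fun u v => rfl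
  have hs := hf.scale_pos
  have hK1 := hf.one_le
  set q := Fintype.card F with hq
  obtain ⟨N, hN⟩ : ∃ N : ℝ, N = (Fintype.card (Fin D → F) : ℝ) := ⟨_, rfl⟩
  have hNpos : 0 < N := by rw [hN]; exact_mod_cast Fintype.card_pos
  set m : H := N⁻¹ • ∑ u, f u with hm
  set g : (Fin D → F) → H := fun u => f u - m with hg
  have hgsub : ∀ u v, ‖g u - g v‖ = dist (f u) (f v) := fun u v => by
    rw [dist_eq_norm, hg]; exact congrArg _ (sub_sub_sub_cancel_right _ _ _)
  have hgsum : ∑ u, g u = 0 := by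
    rw [hg, Finset.sum_sub_distrib, Finset.sum_const, Finset.card_univ,
      ← Nat.cast_smul_eq_nsmul ℝ, ← hN, hm, smul_smul, mul_inv_cancel₀ hNpos.ne', one_smul,
      sub_self]
  -- All multiples of `w x` are generators, so whole lines have diameter at most 1.
  have hup : ∀ (x y : F) (u : Fin D → F), ‖g (u + y • w x) - g u‖ ^ 2 ≤ (s * K) ^ 2 := by
    intro x y u
    rw [hgsub]
    have h1 : dist (u + y • w x) u ≤ 1 := by
      rw [hdist, add_sub_cancel_left]
      exact_mod_cast wordLength_le (r := 1) (by rw [one_nsmul]; exact hmem x y)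
    have h2 : 0 ≤ s * K := by positivity
    have := (hf.upper (u + y • w x) u).trans (mul_le_of_le_one_right h2 h1)
    gcongr
  have hpoin := mul_sum_norm_sq_le w D (fun l hl hlD => span_powers_eq_top D l hl hlD) g hgsum
    ((s * K) ^ 2) hup
  rw [← hN, ← hq] at hpoin
  have hqD : (2 * D : ℝ) ≤ q := by exact_mod_cast hD
  have hqpos : (0 : ℝ) < q := by rw [hq]; exact_mod_cast Fintype.card_pos
  -- Here `2 * D ≤ q` gives `2 * (q - D + 1) ≥ q`.
  have hvar : ∑ u, ‖g u‖ ^ 2 ≤ N * (s * K) ^ 2 := by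
    have h1 : 0 ≤ ∑ u, ‖g u‖ ^ 2 := Finset.sum_nonneg fun _ _ => by positivity
    have h2 : (q : ℝ) * ∑ u, ‖g u‖ ^ 2 ≤ q * (N * (s * K) ^ 2) := by
      rw [← mul_assoc]
      refine le_trans ?_ hpoin
      gcongr
      linarith
    exact le_of_mul_le_mul_left h2 hqpos
  have hball : 2 * (Finset.univ.filter fun g => wordLength B g ≤ r).card ≤
      Fintype.card (Fin D → F) := by
    have h1 : B.card ≤ q ^ 2 := by
      refine Finset.card_image_le.trans ?_
      simp [hq, sq]
    have hq2 : 2 ≤ q := by omega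
    calc _ ≤ 2 * (q ^ 2) ^ r :=
          Nat.mul_le_mul_left _ ((card_wordLength_le h0 hB r).trans (Nat.pow_le_pow_left h1 r))
      _ ≤ q * q ^ (2 * r) := by rw [← pow_mul]; gcongr
      _ = q ^ (2 * r + 1) := by ring
      _ ≤ q ^ D := Nat.pow_le_pow_right (by omega) hr
      _ = _ := by simp [hq]
  have hfar : N / 2 ≤ (Finset.univ.filter fun g => ¬ wordLength B g ≤ r).card := by
    have h1 := Finset.card_filter_add_card_filter_not (s := (Finset.univ : Finset (Fin D → F)))
      (fun g => wordLength B g ≤ r)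
    rw [Finset.card_univ] at h1
    have h2 : Fintype.card (Fin D → F) ≤
        2 * (Finset.univ.filter fun g => ¬ wordLength B g ≤ r).card := by omega
    have h3 : N ≤ 2 * ((Finset.univ.filter fun g => ¬ wordLength B g ≤ r).card : ℝ) := by
      rw [hN]; exact_mod_cast h2
    linarith
  have hrow : ∀ v, N / 2 * (s * (r + 1)) ^ 2 ≤ ∑ u, ‖g u - g v‖ ^ 2 := by
    intro v
    calc N / 2 * (s * (r + 1)) ^ 2
        ≤ (Finset.univ.filter fun g => ¬ wordLength B g ≤ r).card * (s * (r + 1)) ^ 2 := by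
          gcongr
      _ = ∑ x ∈ Finset.univ.filter fun g => ¬ wordLength B g ≤ r, (s * ((r : ℝ) + 1)) ^ 2 := by
          simp
      _ ≤ ∑ x ∈ Finset.univ.filter fun g => ¬ wordLength B g ≤ r, ‖g (x + v) - g v‖ ^ 2 := by
          refine Finset.sum_le_sum fun x hx => ?_
          have h1 : (r : ℝ) + 1 ≤ dist (x + v) v := by
            have := (Finset.mem_filter.1 hx).2
            rw [hdist, add_sub_cancel_right]
            exact_mod_cast not_le.1 this
          rw [hgsub]
          have := (mul_le_mul_of_nonneg_left h1 hs.le).trans (hf.lower (x + v) v)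
          gcongr
      _ ≤ ∑ x, ‖g (x + v) - g v‖ ^ 2 :=
          Finset.sum_le_sum_of_subset_of_nonneg (Finset.subset_univ _) fun _ _ _ => by positivity
      _ = _ := Fintype.sum_equiv (Equiv.addRight v) _ _ fun u => by simp
  have htotal := Finset.sum_le_sum fun (v : Fin D → F) (_ : v ∈ Finset.univ) => hrow v
  rw [Finset.sum_comm, sum_norm_sub_sq g hgsum, Finset.sum_const, Finset.card_univ, nsmul_eq_mul,
    ← hN] at htotal
  have hfin : N * (N * s ^ 2) * ((r : ℝ) + 1) ^ 2 ≤ N * (N * s ^ 2) * (2 * K) ^ 2 := by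
    have : 2 * N * ∑ u, ‖g u‖ ^ 2 ≤ 2 * N * (N * (s * K) ^ 2) := by gcongr
    nlinarith
  have hsq := le_of_mul_le_mul_left hfin (by positivity)
  exact (abs_le_of_sq_le_sq' hsq (by positivity)).2

/-- The bounds are `q ^ D` for `q = 2 ^ a`, `D = 2 ^ (a - 1)`, and its successor in `a`; `4096` is
the case `a = 3`. -/
theorem exists_two_pow_le_and_lt (n : ℕ) (hn : 4096 ≤ n) :
    ∃ a : ℕ, 3 ≤ a ∧ 2 ^ (a * 2 ^ (a - 1)) ≤ n ∧ n < 2 ^ ((a + 1) * 2 ^ a) := by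
  have hex : ∃ b : ℕ, n < 2 ^ (b * 2 ^ (b - 1)) :=
    ⟨n, n.lt_two_pow_self.trans_le
      (Nat.pow_le_pow_right (by norm_num) (Nat.le_mul_of_pos_right _ (by positivity)))⟩
  classical
  have hspec := Nat.find_spec hex
  have hmin := fun b => Nat.find_min (m := b) hex
  generalize Nat.find hex = b at hspec hmin
  have hb : 4 ≤ b := by
    by_contra! h
    interval_cases b <;> norm_num at hspec <;> omega
  obtain ⟨a, rfl⟩ : ∃ a, b = a + 1 := ⟨b - 1, by omega⟩
  exact ⟨a, by omega, not_lt.1 (hmin a (by omega)), hspec⟩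

theorem log_div_log_log_le (a n : ℕ) (ha : 3 ≤ a) (h1 : 2 ^ (a * 2 ^ (a - 1)) ≤ n)
    (h2 : n < 2 ^ ((a + 1) * 2 ^ a)) :
    Real.log n / Real.log (Real.log n) ≤ 2 * 2 ^ a := by
  have hl2 : 0.69 < Real.log 2 := by linarith [Real.log_two_gt_d9]
  have ha' : (3 : ℝ) ≤ a := by exact_mod_cast ha
  have hn : (0 : ℝ) < n := by
    have : 0 < n := lt_of_lt_of_le (by positivity) h1
    exact_mod_cast this
  have hlow : (2 : ℝ) ^ a ≤ Real.log n := by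
    have h3 : ((2 : ℝ) ^ (a * 2 ^ (a - 1))) ≤ n := by exact_mod_cast h1
    have h4 := Real.log_le_log (by positivity) h3
    rw [Real.log_pow] at h4
    refine le_trans ?_ h4
    obtain ⟨b, rfl⟩ : ∃ b, a = b + 1 := ⟨a - 1, by omega⟩
    rw [Nat.add_sub_cancel, pow_succ]
    push_cast at ha' ⊢
    -- This is where `a ≥ 3` is needed.
    have : (2 : ℝ) ≤ (b + 1) * Real.log 2 := by nlinarith
    calc (2 : ℝ) ^ b * 2 ≤ 2 ^ b * ((b + 1) * Real.log 2) := by gcongr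
      _ = _ := by ring
  have hup : Real.log n ≤ (a + 1) * 2 ^ a * Real.log 2 := by
    have h3 : (n : ℝ) ≤ (2 : ℝ) ^ ((a + 1) * 2 ^ a) := by exact_mod_cast h2.le
    have h4 := Real.log_le_log hn h3
    rw [Real.log_pow] at h4
    push_cast at h4
    exact h4
  have hll : a * Real.log 2 ≤ Real.log (Real.log n) := by
    rw [← Real.log_pow]
    exact Real.log_le_log (by positivity) hlow
  have hpos : 0 < a * Real.log 2 := by positivity
  rw [div_le_iff₀ (hpos.trans_le hll)]
  calc Real.log n ≤ (a + 1) * 2 ^ a * Real.log 2 := hup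
    _ ≤ (2 * a) * 2 ^ a * Real.log 2 := by gcongr; linarith
    _ = 2 * 2 ^ a * (a * Real.log 2) := by ring
    _ ≤ _ := by gcongr

/-- Every finite metric space is isometric to a subspace of a finite metric space with
a prescribed larger number of points. -/
theorem exists_isometry_card_eq (G : Type) [MetricSpace G] [Fintype G] (n : ℕ)
    (hn : Fintype.card G ≤ n) :
    ∃ (X : Type) (_ : MetricSpace X) (_ : Fintype X) (e : G → X),
      Fintype.card X = n ∧ Isometry e := by
  classical
  rcases isEmpty_or_nonempty G with hG | hG
  · exact ⟨(Finset.range n : Finset ℕ), inferInstance, inferInstance, fun x => hG.elim x,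
      by simp, fun x => hG.elim x⟩
  -- Pad `G × {0}` with further points of `G × ℕ` under the max metric.
  set t : Finset (G × ℕ) := Finset.univ.image fun u : G => (u, 0)
  obtain ⟨T, hT, hTn⟩ := Infinite.exists_superset_card_eq t n
    (Finset.card_image_le.trans (by simpa using hn))
  refine ⟨T, inferInstance, inferInstance,
    fun u => ⟨(u, 0), hT (Finset.mem_image_of_mem _ (Finset.mem_univ u))⟩, by simpa using hTn, ?_⟩
  refine Isometry.of_dist_eq fun u v => ?_
  rw [Subtype.dist_eq, Prod.dist_eq]
  simp

theorem IsBiLipschitzWith.comp {X Y Z : Type*} [MetricSpace X] [MetricSpace Y] [MetricSpace Z]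
    {g : Y → Z} {f : X → Y} {s D s' D' : ℝ} (hg : IsBiLipschitzWith g s' D')
    (hf : IsBiLipschitzWith f s D) : IsBiLipschitzWith (g ∘ f) (s' * s) (D' * D) where
  scale_pos := mul_pos hg.scale_pos hf.scale_pos
  one_le := one_le_mul_of_one_le_of_one_le hg.one_le hf.one_le
  lower x y := by
    rw [mul_assoc]
    exact (mul_le_mul_of_nonneg_left (hf.lower x y) hg.scale_pos.le).trans (hg.lower _ _)
  upper x y := by
    have h : 0 ≤ s' * D' := mul_nonneg hg.scale_pos.le (zero_le_one.trans hg.one_le)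
    refine (hg.upper _ _).trans ((mul_le_mul_of_nonneg_left (hf.upper x y) h).trans (le_of_eq ?_))
    ring

theorem Isometry.isBiLipschitzWith {X Y : Type*} [MetricSpace X] [MetricSpace Y] {e : X → Y}
    (he : Isometry e) : IsBiLipschitzWith e 1 1 where
  scale_pos := one_pos
  one_le := le_rfl
  lower x y := by rw [he.dist_eq, one_mul]
  upper x y := by rw [he.dist_eq, one_mul, one_mul]

theorem exists_metricSpace_log_div_log_log_le (H : Type*) [NormedAddCommGroup H]
    [InnerProductSpace ℝ H] (n : ℕ) (hn : 4096 ≤ n) :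
    ∃ (X : Type) (_ : MetricSpace X) (_ : Fintype X), Fintype.card X = n ∧
      ∀ (f : X → H) (s D : ℝ), IsBiLipschitzWith f s D →
        Real.log n / Real.log (Real.log n) ≤ 16 * D := by
  obtain ⟨a, ha, h1, h2⟩ := exists_two_pow_le_and_lt n hn
  have : Fintype (GaloisField 2 a) := Fintype.ofFinite _
  have hcard : Fintype.card (GaloisField 2 a) = 2 ^ a := by
    rw [← Nat.card_eq_fintype_card, GaloisField.card 2 a (by omega)]
  obtain ⟨b, rfl⟩ : ∃ b, a = b + 2 := ⟨a - 2, by omega⟩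
  have hb : 0 < 2 ^ b := by positivity
  -- With `a = b + 2`: `q = 2 * D`, and `r + 1 = 2 ^ b = D / 2` is the largest admissible choice.
  -- Then `2 * 2 ^ a = 8 * (r + 1)`, whence the factor 16.
  obtain ⟨inst, hG⟩ := exists_metricSpace_le_distortion (GaloisField 2 (b + 2)) H (2 ^ (b + 1))
    (2 ^ b - 1) (by rw [pow_succ]; omega) (by rw [hcard, pow_succ 2 (b + 1)]; omega)
  obtain ⟨X, instX, instF, e, hX, he⟩ := exists_isometry_card_eq
    (Fin (2 ^ (b + 1)) → GaloisField 2 (b + 2)) n (by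
      rw [Fintype.card_fun, hcard, Fintype.card_fin, ← pow_mul]
      exact h1)
  refine ⟨X, instX, instF, hX, fun f s D hf => ?_⟩
  have h3 := hG _ _ _ (hf.comp he.isBiLipschitzWith)
  rw [Nat.cast_sub hb] at h3
  push_cast at h3
  refine (log_div_log_log_le _ n ha h1 h2).trans ?_
  rw [pow_add]
  linarith

end HilbertDistortion

theorem mainTheorem9 (d : ℕ) (R : Type*) [MetricSpace R]
    [ChartedSpace (EuclideanSpace ℝ (Fin d)) R] [IsManifold (𝓡 d) ∞ R]
    [RiemannianBundle (fun x : R => TangentSpace (𝓡 d) x)]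
    [IsContMDiffRiemannianBundle (𝓡 d) ∞ (EuclideanSpace ℝ (Fin d))
      (fun x : R => TangentSpace (𝓡 d) x)]
    [IsRiemannianManifold (𝓡 d) R]
    (hR : ∃ ψ : R → EllTwo, IsBiLipschitzEmbedding ψ) :
    ∃ c : ℝ, 0 < c ∧ ∀ n : ℕ, 1 ≤ n →
      ∃ (X : Type) (_ : MetricSpace X) (_ : Fintype X), Fintype.card X = n ∧
        ∀ f : X → R, IsBiLipschitzEmbedding f →
          c * (Real.log n / Real.log (Real.log n)) ≤ distortion f := by
  obtain ⟨ψ, s₀, D₀, hψ⟩ := hR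
  have hD₀ : 0 < D₀ := one_pos.trans_le hψ.one_le
  -- The finitely many small `n` are absorbed into the constant, since distortion is at least 1.
  obtain ⟨C, hC⟩ := ((Set.finite_lt_nat 4096).image
    fun n : ℕ => Real.log n / Real.log (Real.log n)).bddAbove
  set M : ℝ := max 16 C with hM
  have hMpos : 0 < M := lt_of_lt_of_le (by norm_num) (le_max_left _ _)
  refine ⟨(M * D₀)⁻¹, by positivity, fun n _ => ?_⟩
  suffices h : ∃ (X : Type) (_ : MetricSpace X) (_ : Fintype X), Fintype.card X = n ∧
      ∀ (f : X → EllTwo) (s D : ℝ), IsBiLipschitzWith f s D →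
        Real.log n / Real.log (Real.log n) ≤ M * D by
    obtain ⟨X, instX, instF, hX, h⟩ := h
    refine ⟨X, instX, instF, hX, fun f hf => le_csInf ?_ ?_⟩
    · obtain ⟨s, D, hf⟩ := hf
      exact ⟨D, s, hf⟩
    · rintro D ⟨s, hf⟩
      rw [inv_mul_le_iff₀ (by positivity), mul_assoc]
      exact h _ _ _ (hψ.comp hf)
  rcases lt_or_ge n 4096 with hn | hn
  · refine ⟨(Finset.range n : Finset ℕ), inferInstance, inferInstance, by simp,
      fun f s D hf => ?_⟩
    calc Real.log n / Real.log (Real.log n) ≤ C := hC ⟨n, hn, rfl⟩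
      _ ≤ M := le_max_right _ _
      _ ≤ M * D := le_mul_of_one_le_right hMpos.le hf.one_le
  · obtain ⟨X, instX, instF, hX, h⟩ := exists_metricSpace_log_div_log_log_le EllTwo n hn
    refine ⟨X, instX, instF, hX, fun f s D hf => (h f s D hf).trans ?_⟩
    have := zero_le_one.trans hf.one_le
    gcongr
    exact le_max_left _ _
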